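/- Setting. Let $d=p+q$ and let $Z_1,Z_2,\dots$, $Z_i=(X_i,Y_i)\in\mathbb{R}^p\times\mathbb{R}^q$, be i.i.d. with law $P$. The null hypothesis $\mathcal H_0$ says that $X$ and $Y$ are independent under $P$: $P(A\times B)=P(\mathbb{R}^p\times B)\,P(A\times\mathbb{R}^q)$ for all Borel $A,B$. For a sample $z_1,\dots,z_n$ let $\hat P_n$ be the empirical distribution and, for product sets, $\hat Q^*_n(A^1\times A^2)=\hat P_n(A^1\times\mathbb{R}^q)\,\hat P_n(\mathbb{R}^p\times A^2)$. Let $b_n,\delta_n\in(0,1)$ for $n\ge 1$. The full tree $T^{full}_{b_n}$ is the binary tree of cells grown from the root cell $\mathbb{R}^d$: for each cell a coordinate in $\{1,\dots,d\}$ is selected (by an arbitrary, possibly data-dependent rule), the cell is cut along this coordinate at the median of the sample points it contains (the entry of rank $\lceil N/2\rceil$ of the $N$ ordered values; the left child takes the values $\le$ the median, the right child the values $>$ it), and the split is kept if and only if both new cells have empirical probability at least $b_n$. A pruned tree $T\ll T^{full}_{b_n}$ is a binary subtree with the same root, $|T|$ is its number of leaves, and $\pi_T$ is the partition of $\mathbb{R}^d$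 into the cells of its leaves. Let $$\hat T_{b_n,\delta_n}\in\arg\max_{T\ll T^{full}_{b_n}}\ \sum_{A\in\pi_T}\hat P_n(A)\log\frac{\hat P_n(A)}{\hat Q^*_n(A)}-r_{b_n,\delta_n}(|T|)$$ (any choice of maximizer), where $r_{b_n,\delta_n}(1)=0$ and, for $k\ge2$, $$r_{b_n,\delta_n}(k)=\frac{24\sqrt2}{b_n\sqrt n}\sqrt{\ln\frac{8}{\delta_n b_n}+k\,[(d+1)\ln2+d\ln n]}.$$ Let $\pi_n=\pi_{\hat T_{b_n,\delta_n}}$, and let $\mathcal T_0=\sup\{m\ge1:|\hat T_{b_m,\delta_m}|>1\}\in\mathbb{N}\cup\{\infty\}$ ($\sup\emptyset=0$) be the collapse time. Write $u_n\approx v_n$ if the two positive sequences are of the same order, i.e. $c\,v_n\le u_n\le C\,v_n$ for some constants $0<c\le C$ and all large $n$. Theorem. There is a universal constant $K>0$ (depending on none of $p$, $q$, $P$, $l$, $(b_n)$, $(\delta_n)$, or the selection rules) such that the following holds. Suppose that $b_n\approx n^{-l}$ for some $l\in(0,1/3)$, that $1/\delta_n\approx e^{n^{1/3}}$, and that $\mathcal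 H_0$ holds. Then $$\mathbb{P}(\mathcal T_0\ge m)\le K e^{-m^{1/3}}\qquad\text{for every } m\ge1 .$$ Moreover, for $\varepsilon>0$ let $m(\varepsilon)$ be the least integer $m\ge1$ with $K e^{-m^{1/3}}<\varepsilon$. Then, under the same assumptions, independence is detected structurally from $m(\varepsilon)$ samples on with confidence $1-\varepsilon$: the probability that $\pi_n\ne\{\mathbb{R}^d\}$ for some $n\ge m(\varepsilon)$ is less than $\varepsilon$. As $\varepsilon\to0^+$, $m(\varepsilon)\sim(\ln(K/\varepsilon))^3$, and in particular $m(\varepsilon)=O\big((\ln(1/\varepsilon))^3\big)$. -/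

import Mathlib

open MeasureTheory ProbabilityTheory Filter Topology Asymptotics

namespace TSP

/-- The joint space `ℝ^d = ℝ^p × ℝ^q` of `(X, Y)`, with its Borel (product) sigma-field. -/
abbrev JointSpace (p q : ℕ) : Type := (Fin p → ℝ) × (Fin q → ℝ)

/-- The `d = p + q` coordinates of the joint space. -/
abbrev Coord (p q : ℕ) : Type := Fin p ⊕ Fin q

/-- The value of the coordinate `c` of the point `z`. -/
def coordVal {p q : ℕ} (c : Coord p q) (z : JointSpace p q) : ℝ :=
  match c with
  | Sum.inl j => z.1 j
  | Sum.inr j => z.2 j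

/-- The class of laws on `ℝ^p × ℝ^q` under which `X` and `Y` are independent (the null
hypothesis). -/
def IndependenceClass (p q : ℕ) : Set (Measure (JointSpace p q)) :=
  {P | IsProbabilityMeasure P ∧
    ∀ (A : Set (Fin p → ℝ)) (B : Set (Fin q → ℝ)), MeasurableSet A → MeasurableSet B →
      P (A ×ˢ B) = P (Set.univ ×ˢ B) * P (A ×ˢ Set.univ)}

/-- A set `A = A¹ × A²` with product structure, given by its two factors. -/
abbrev ProdCell (p q : ℕ) : Type := Set (Fin p → ℝ) × Set (Fin q → ℝ)

/-- The subset `A¹ × A²` of the joint space. -/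
def ProdCell.toSet {p q : ℕ} (A : ProdCell p q) : Set (JointSpace p q) := A.1 ×ˢ A.2

open Classical in
/-- The empirical probability `P̂ₙ(A)` of the set `A` under the sample `z`. -/
noncomputable def empProb {p q n : ℕ} (z : Fin n → JointSpace p q)
    (A : Set (JointSpace p q)) : ℝ :=
  ((Finset.univ.filter fun i => z i ∈ A).card : ℝ) / n

/-- The product of the empirical marginals,
`Q̂*ₙ(A¹ × A²) = P̂ₙ(A¹ × ℝ^q) * P̂ₙ(ℝ^p × A²)`. -/
noncomputable def empProdProb {p q n : ℕ} (z : Fin n → JointSpace p q)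
    (A : ProdCell p q) : ℝ :=
  empProb z (A.1 ×ˢ Set.univ) * empProb z (Set.univ ×ˢ A.2)

open Classical in
/-- The median of the coordinates `c` of those sample points that lie in `A`: the entry of
rank `⌈N / 2⌉` in the ordered list of the `N` projected points. -/
noncomputable def cellMedian {p q n : ℕ} (z : Fin n → JointSpace p q) (c : Coord p q)
    (A : Set (JointSpace p q)) : ℝ :=
  let s : List ℝ :=
    ((Finset.univ.filter fun i => z i ∈ A).val.map fun i => coordVal c (z i)).sort (· ≤ ·)
  s.getD ((s.length - 1) / 2) 0

/-- The two half-lines cut at `t`: `(-∞, t]` (left, `false`) and `(t, ∞)` (right, `true`). -/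
def halfLine (t : ℝ) : Bool → Set ℝ
  | false => Set.Iic t
  | true => Set.Ioi t

/-- The part of `A` on the side `s` of the hyperplane on which coordinate `c` equals `t`. -/
def splitCell {p q : ℕ} (c : Coord p q) (t : ℝ) (s : Bool) (A : ProdCell p q) : ProdCell p q :=
  match c with
  | Sum.inl j => (A.1 ∩ {x | x j ∈ halfLine t s}, A.2)
  | Sum.inr j => (A.1, A.2 ∩ {y | y j ∈ halfLine t s})

/-- A node of the infinite binary tree, addressed by the path from the root, the last step
first: `[]` is the root, `false :: v` and `true :: v` are the left and right children of `v`. -/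
abbrev Node : Type := List Bool

/-- The cell `A_v`: the root has the whole space, and the cell of `v` is split at the median of
the sample points that it contains, along the coordinate `axis v` selected for `v`. -/
noncomputable def cell {p q n : ℕ} (z : Fin n → JointSpace p q) (axis : Node → Coord p q) :
    Node → ProdCell p q
  | [] => (Set.univ, Set.univ)
  | s :: v =>
    splitCell (axis v) (cellMedian z (axis v) (cell z axis v).toSet) s (cell z axis v)

/-- Membership in the full tree: a node is split if and only if both created cells have
empirical probability at least `b`. -/
def InFullTree {p q n : ℕ} (z : Fin n → JointSpace p q) (axis : Node → Coord p q) (b : ℝ) :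
    Node → Prop
  | [] => True
  | _ :: v => InFullTree z axis b v ∧ ∀ s' : Bool, b ≤ empProb z (cell z axis (s' :: v)).toSet

/-- The shape of a finite binary tree: a single node, or a root with two subtrees. -/
inductive BinTree : Type
  | leaf : BinTree
  | node (l r : BinTree) : BinTree

/-- The nodes of the tree `T` when its root is placed at `v`. -/
def BinTree.nodesFrom : BinTree → Node → List Node
  | .leaf, v => [v]
  | .node l r, v => v :: (l.nodesFrom (false :: v) ++ r.nodesFrom (true :: v))

/-- The leaves (terminal nodes) of the tree `T` when its root is placed at `v`. -/
def BinTree.leavesFrom : BinTree → Node → List Node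
  | .leaf, v => [v]
  | .node l r, v => l.leavesFrom (false :: v) ++ r.leavesFrom (true :: v)

/-- The nodes of a tree with root `[]`. -/
def BinTree.nodes (T : BinTree) : List Node := T.nodesFrom []

/-- The leaves `ℒ(T)` of a tree with root `[]`. -/
def BinTree.leaves (T : BinTree) : List Node := T.leavesFrom []

/-- The size `|T|` of a tree: its number of leaves, i.e. of cells of `π_T`. -/
def BinTree.size (T : BinTree) : ℕ := T.leaves.length

/-- `T` is a pruned version of the full tree (`T ≪ T^full_b`): a binary tree with the same
root, all of whose nodes are nodes of the full tree. -/
def IsPruned {p q n : ℕ} (z : Fin n → JointSpace p q) (axis : Node → Coord p q) (b : ℝ)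
    (T : BinTree) : Prop :=
  ∀ v ∈ T.nodes, InFullTree z axis b v

/-- The data-driven partition `π_T = {A_v : v ∈ ℒ(T)}` of the joint space. -/
def treePartition {p q n : ℕ} (z : Fin n → JointSpace p q) (axis : Node → Coord p q)
    (T : BinTree) : Set (Set (JointSpace p q)) :=
  {A | ∃ v ∈ T.leaves, A = (cell z axis v).toSet}

/-- The empirical divergence `D_{σ(π_T)}(P̂ₙ ‖ Q̂*ₙ)` restricted to the cells of `π_T`. -/
noncomputable def empDivergence {p q n : ℕ} (z : Fin n → JointSpace p q)
    (axis : Node → Coord p q) (T : BinTree) : ℝ :=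
  (T.leaves.map fun v =>
    empProb z (cell z axis v).toSet *
      Real.log (empProb z (cell z axis v).toSet / empProdProb z (cell z axis v))).sum

/-- The confidence radius `ε_c(n, b, d, δ, k)`. -/
noncomputable def confRadius (n : ℕ) (b : ℝ) (d : ℕ) (δ : ℝ) (k : ℕ) : ℝ :=
  24 * √2 / (b * √(n : ℝ)) *
    √(Real.log (8 / δ) + k * ((d + 1) * Real.log 2 + d * Real.log n))

/-- The penalty `r_{b,δ}(k) = ε_c(n, b, d, δ b, k)` of a tree of size `k`, with the convention
`r_{b,δ}(1) = 0` for the trivial tree (whose divergence is zero, with no estimation error). -/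
noncomputable def penalty (n : ℕ) (b : ℝ) (d : ℕ) (δ : ℝ) (k : ℕ) : ℝ :=
  if k = 1 then 0 else confRadius n b d (δ * b) k

/-- The objective of the regularized empirical information maximization. -/
noncomputable def objective {p q n : ℕ} (z : Fin n → JointSpace p q)
    (axis : Node → Coord p q) (b δ : ℝ) (T : BinTree) : ℝ :=
  empDivergence z axis T - penalty n b (p + q) δ T.size

/-- `T` is a solution of the regularized empirical information maximization over the pruned
versions of the full tree. -/
def IsOptimalTree {p q n : ℕ} (z : Fin n → JointSpace p q) (axis : Node → Coord p q)
    (b δ : ℝ) (T : BinTree) : Prop :=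
  IsPruned z axis b T ∧
    ∀ T', IsPruned z axis b T' → objective z axis b δ T' ≤ objective z axis b δ T

/-- The first `n` terms `z_1, …, z_n` of a sequence of points. -/
def firstSamples {p q : ℕ} (z : ℕ → JointSpace p q) (n : ℕ) : Fin n → JointSpace p q :=
  fun i => z i

/-- The collapse time `𝒯₀ = sup {m ≥ 1 : |T̂_m| > 1}`, with values in `ℕ ∪ {∞}`, of a rule
`That` that assigns a tree to each finite sample. -/
noncomputable def collapseTime {p q : ℕ} (That : ∀ n : ℕ, (Fin n → JointSpace p q) → BinTree)
    (z : ℕ → JointSpace p q) : ℕ∞ :=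
  ⨆ m ∈ {m : ℕ | 1 ≤ m ∧ 1 < (That m (firstSamples z m)).size}, (m : ℕ∞)

/-- The critical number of samples `m(ε)`: the least `m ≥ 1` with `K e^{-m^{1/3}} < ε`. -/
noncomputable def criticalSize (K ε : ℝ) : ℕ :=
  sInf {m : ℕ | 1 ≤ m ∧ K * Real.exp (-((m : ℝ) ^ (1 / 3 : ℝ))) < ε}

end TSP

open TSP

/-! Under the null hypothesis the law of the sample is unchanged when the `Y`-components are
permuted. It is therefore enough to fix the sample and average over a uniform permutation. If a
product box has marginal index sets `I` and `J`, its count becomes hypergeometric with mean `m =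
|I||J|/n`. Its generating function is dominated by the Poisson one, so the count equals `j ≥ 1` with
probability at most `exp (-poissonRate j m)` (`card_hits_eq_le`).

Cells of the full tree are data-dependent, but their thresholds are coordinates of sample points,
whatever rule selects the axes (`exists_cell_eq_gridBox`). A union bound over `(n+1)^(2d)` grid
boxes thus covers all trees at once (`measure_gridDeviation_le`).

The empirical divergence of a tree is the sum of `poissonRate` over its leaves, since both empirical
laws have total mass 1. A nontrivial optimal tree must beat the trivial one, so its divergence is at
least its penalty. Each leaf has mass at least `b`, so the factor `1/b` in the penalty is at least
the number of leaves. Hence some leaf has rate at least `deviationLevel / n`, that is, Chernoff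
exponent at least `deviationLevel`, for its count (`mem_gridDeviation_of_one_lt_size`).

That level is of order `√n √s`, where `exp s` bounds the number of boxes. Either it exceeds the
largest possible exponent `2n`, or `s` is absorbed and the event has probability at most
`e^(-n^(1/3)) / n²`. Summing over `n ≥ m` gives the tail with `K = ∑ 1/n²`; inverting it gives
`m(ε)`. -/

namespace TSP

/-! ### Chernoff bounds for hypergeometric counts, by counting permutations -/

section Permutations

variable {α : Type*} [Fintype α] [DecidableEq α]

/-- The number of elements of `I` that the permutation `σ` sends into `J`. -/
def hits (I J : Finset α) (σ : Equiv.Perm α) : ℕ := (I.filter fun i => σ i ∈ J).card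

/-- The permutations that send `S` into `J`. -/
def permsInto (S J : Finset α) : Finset (Equiv.Perm α) :=
  Finset.univ.filter fun σ => ∀ a ∈ S, σ a ∈ J

theorem card_filter_perm_mem (J : Finset α) (σ : Equiv.Perm α) :
    (Finset.univ.filter fun i => σ i ∈ J).card = J.card := by
  rw [← Finset.card_map σ.symm.toEmbedding (s := J)]
  congr 1
  ext i
  simp [Finset.mem_map_equiv]

/-- For `i' ∉ S`, precomposing with the transposition of `i` and `i'` moves the constraint from `i`
to `i'`. For `i' ∈ S` the constraint at `i'` is already there. Summing over `i'` then gives the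
ratio `|J|/n` for each added constraint. -/
theorem card_permsInto_insert_le (J : Finset α) {S : Finset α} {i : α} (hi : i ∉ S) (i' : α) :
    (permsInto (insert i S) J).card ≤ ((permsInto S J).filter fun σ => σ i' ∈ J).card := by
  by_cases hi' : i' ∈ S
  · apply Finset.card_le_card
    intro σ
    simp only [permsInto, Finset.mem_filter, Finset.mem_univ, true_and]
    exact fun h => ⟨fun a ha => h a (Finset.mem_insert_of_mem ha),
      h i' (Finset.mem_insert_of_mem hi')⟩
  · apply Finset.card_le_card_of_injOn (fun σ => σ * Equiv.swap i i')
    · intro σ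
      simp only [permsInto, Finset.mem_coe, Finset.mem_filter, Finset.mem_univ, true_and]
      intro h
      refine ⟨fun a ha => ?_, ?_⟩
      · rw [Equiv.Perm.mul_apply, Equiv.swap_apply_of_ne_of_ne]
        · exact h a (Finset.mem_insert_of_mem ha)
        · rintro rfl; exact hi ha
        · rintro rfl; exact hi' ha
      · simpa using h i (Finset.mem_insert_self _ _)
    · exact fun σ _ τ _ h => mul_right_cancel h

theorem card_mul_card_permsInto_insert_le (J : Finset α) {S : Finset α} {i : α} (hi : i ∉ S) :
    Fintype.card α * (permsInto (insert i S) J).card ≤ J.card * (permsInto S J).card := by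
  calc Fintype.card α * (permsInto (insert i S) J).card
      = ∑ _i' : α, (permsInto (insert i S) J).card := by simp
    _ ≤ ∑ i' : α, ((permsInto S J).filter fun σ => σ i' ∈ J).card :=
        Finset.sum_le_sum fun i' _ => card_permsInto_insert_le J hi i'
    _ = ∑ σ ∈ permsInto S J, (Finset.univ.filter fun i' => σ i' ∈ J).card := by
        simp only [Finset.card_filter]
        exact Finset.sum_comm
    _ = J.card * (permsInto S J).card := by
        simp [card_filter_perm_mem, mul_comm]

/-- Sampling without replacement hits `J` at all points of `S` no more often than independent draws
would. -/
theorem card_permsInto_le [Nonempty α] (J S : Finset α) :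
    ((permsInto S J).card : ℝ) ≤
      (Fintype.card α).factorial * ((J.card : ℝ) / Fintype.card α) ^ S.card := by
  have hn : (0 : ℝ) < Fintype.card α := by exact_mod_cast Fintype.card_pos
  induction S using Finset.induction_on with
  | empty => simp [permsInto, Fintype.card_perm]
  | insert i S hi ih =>
    rw [Finset.card_insert_of_notMem hi, pow_succ]
    have h : (Fintype.card α : ℝ) * (permsInto (insert i S) J).card ≤
        J.card * (permsInto S J).card := by
      exact_mod_cast card_mul_card_permsInto_insert_le J hi
    have h2 : ((permsInto (insert i S) J).card : ℝ) ≤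
        (permsInto S J).card * (J.card / Fintype.card α) := by
      rw [mul_div_assoc', le_div_iff₀ hn]
      linarith
    refine h2.trans ?_
    rw [← mul_assoc]
    gcongr

/-- Expanding the power over subsets of `I` gives coefficients `x ^ |S|`, nonnegative for `x ≥ 0`.
The comparison with independent draws then applies term by term and yields the binomial generating
function. -/
theorem sum_one_add_pow_hits_le [Nonempty α] (I J : Finset α) {x : ℝ} (hx : 0 ≤ x) :
    ∑ σ : Equiv.Perm α, (1 + x) ^ hits I J σ ≤
      (Fintype.card α).factorial * (1 + x * (J.card / Fintype.card α)) ^ I.card := by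
  have h1 : ∀ σ : Equiv.Perm α, (1 + x) ^ hits I J σ =
      ∑ S ∈ I.powerset, if σ ∈ permsInto S J then x ^ S.card else 0 := by
    intro σ
    have : (1 + x) ^ hits I J σ = ∏ i ∈ I, (1 + if σ i ∈ J then x else 0) := by
      rw [hits, ← Finset.prod_const, Finset.prod_filter]
      refine Finset.prod_congr rfl fun i _ => ?_
      split_ifs <;> simp
    rw [this, Finset.prod_one_add]
    refine Finset.sum_congr rfl fun S _ => ?_
    rw [Finset.prod_ite_zero]
    simp [permsInto]
  have h2 : (1 + x * ((J.card : ℝ) / Fintype.card α)) ^ I.card =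
      ∑ S ∈ I.powerset, (x * ((J.card : ℝ) / Fintype.card α)) ^ S.card := by
    rw [← Finset.prod_const, Finset.prod_one_add]
    simp
  simp only [h1]
  rw [Finset.sum_comm, h2, Finset.mul_sum]
  refine Finset.sum_le_sum fun S _ => ?_
  rw [← Finset.sum_filter, Finset.filter_univ_mem, Finset.sum_const, nsmul_eq_mul, mul_pow]
  calc ((permsInto S J).card : ℝ) * x ^ S.card
      ≤ ((Fintype.card α).factorial * ((J.card : ℝ) / Fintype.card α) ^ S.card) * x ^ S.card := by
        gcongr
        exact card_permsInto_le J S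
    _ = _ := by ring

theorem hits_add_hits_compl (I J : Finset α) (σ : Equiv.Perm α) :
    hits I J σ + hits I Jᶜ σ = I.card := by
  simp only [hits, Finset.mem_compl]
  exact Finset.card_filter_add_card_filter_not _

theorem sum_pow_hits_le [Nonempty α] (I J : Finset α) {r : ℝ} (hr : 0 < r) :
    ∑ σ : Equiv.Perm α, r ^ hits I J σ ≤ (Fintype.card α).factorial *
      Real.exp ((r - 1) * (I.card * J.card / Fintype.card α)) := by
  have hn : (0 : ℝ) < Fintype.card α := by exact_mod_cast Fintype.card_pos
  have hJ : (J.card : ℝ) / Fintype.card α ≤ 1 := by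
    rw [div_le_one hn]; exact_mod_cast Finset.card_le_univ J
  have hJ0 : (0 : ℝ) ≤ (J.card : ℝ) / Fintype.card α := by positivity
  have key : ∑ σ : Equiv.Perm α, r ^ hits I J σ ≤ (Fintype.card α).factorial *
      (1 + (r - 1) * (J.card / Fintype.card α)) ^ I.card := by
    rcases le_total 1 r with h1 | h1
    · simpa using sum_one_add_pow_hits_le I J (x := r - 1) (by linarith)
    -- For `r ≤ 1` the expansion would have signs. Counting the hits in `Jᶜ` instead replaces `r` by
    -- `r⁻¹ ≥ 1`.
    · have hinv : 0 ≤ r⁻¹ - 1 := sub_nonneg.2 ((one_le_inv₀ hr).2 h1)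
      have h2 : ∀ σ : Equiv.Perm α, r ^ hits I J σ =
          r ^ I.card * (1 + (r⁻¹ - 1)) ^ hits I Jᶜ σ := by
        intro σ
        rw [← hits_add_hits_compl I J σ, pow_add, mul_assoc, ← mul_pow]
        simp [hr.ne']
      simp only [h2]
      rw [← Finset.mul_sum]
      refine (mul_le_mul_of_nonneg_left (sum_one_add_pow_hits_le I Jᶜ hinv)
        (by positivity)).trans (le_of_eq ?_)
      rw [mul_left_comm, ← mul_pow, Finset.card_compl, Nat.cast_sub (Finset.card_le_univ J)]
      congr 2
      field_simp
      ring
  refine key.trans ?_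
  have h3 : (r - 1) * (I.card * J.card / Fintype.card α : ℝ) =
      I.card * ((r - 1) * (J.card / Fintype.card α)) := by ring
  rw [h3, Real.exp_nat_mul]
  gcongr
  · nlinarith
  · linarith [Real.add_one_le_exp ((r - 1) * ((J.card : ℝ) / Fintype.card α))]

/-- The Chernoff exponent of a count `j` whose mean is `m`. -/
noncomputable def poissonRate (j m : ℝ) : ℝ := j * Real.log (j / m) - j + m

/-- Markov's inequality with the optimal parameter `r = j / m`. It may lie on either side of 1, so
both tails are covered. -/
theorem card_hits_eq_le [Nonempty α] (I J : Finset α) {j : ℕ} (hj : 1 ≤ j) :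
    ((Finset.univ.filter fun σ : Equiv.Perm α => hits I J σ = j).card : ℝ) ≤
      (Fintype.card α).factorial *
        Real.exp (-poissonRate j (I.card * J.card / Fintype.card α)) := by
  have hn : (0 : ℝ) < Fintype.card α := by exact_mod_cast Fintype.card_pos
  have hj0 : (0 : ℝ) < j := by exact_mod_cast hj
  rcases (Finset.univ.filter fun σ : Equiv.Perm α => hits I J σ = j).eq_empty_or_nonempty
    with he | ⟨σ, hσ⟩
  · rw [he]; simp; positivity
  rw [Finset.mem_filter] at hσ
  -- One permutation with `j ≥ 1` hits makes `I` and `J` nonempty, so `m > 0` and `r` is meaningful.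
  obtain ⟨i, hi⟩ : (I.filter fun i => σ i ∈ J).Nonempty := by
    rw [← Finset.card_pos]; change 0 < hits I J σ; omega
  rw [Finset.mem_filter] at hi
  have hI : (0 : ℝ) < I.card := by exact_mod_cast Finset.card_pos.2 ⟨i, hi.1⟩
  have hJ : (0 : ℝ) < J.card := by exact_mod_cast Finset.card_pos.2 ⟨_, hi.2⟩
  set m : ℝ := I.card * J.card / Fintype.card α with hm
  have hm0 : 0 < m := by positivity
  have hr : 0 < (j : ℝ) / m := by positivity
  have h1 := sum_pow_hits_le I J hr
  rw [← hm] at h1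
  have h2 : ((Finset.univ.filter fun σ : Equiv.Perm α => hits I J σ = j).card : ℝ) *
      ((j : ℝ) / m) ^ j ≤ ∑ σ : Equiv.Perm α, ((j : ℝ) / m) ^ hits I J σ := by
    rw [← nsmul_eq_mul, ← Finset.sum_const]
    calc _ = ∑ σ ∈ Finset.univ.filter fun σ : Equiv.Perm α => hits I J σ = j,
          ((j : ℝ) / m) ^ hits I J σ :=
          Finset.sum_congr rfl fun σ hσ => by rw [(Finset.mem_filter.1 hσ).2]
      _ ≤ _ := Finset.sum_le_sum_of_subset_of_nonneg (Finset.subset_univ _)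
          fun _ _ _ => by positivity
  have h3 : ((j : ℝ) / m) ^ j = Real.exp (j * Real.log (j / m)) := by
    rw [Real.exp_nat_mul, Real.exp_log hr]
  have h4 : ((j : ℝ) / m - 1) * m = j - m := by field_simp
  rw [h4] at h1
  have h5 : Real.exp (-poissonRate j m) * Real.exp (j * Real.log (j / m)) =
      Real.exp (j - m) := by
    rw [← Real.exp_add, poissonRate]; ring_nf
  have h6 := h2.trans h1
  rw [h3, ← h5, ← mul_assoc] at h6
  exact le_of_mul_le_mul_right h6 (Real.exp_pos _)

/-- Split by the value `j` of the count: there are at most `n` values, and each one that occurs has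
rate at least `τ`. No monotonicity of the rate is needed. -/
theorem card_poissonRate_hits_ge_le [Nonempty α] (I J : Finset α) (τ : ℝ) :
    ((Finset.univ.filter fun σ : Equiv.Perm α => 1 ≤ hits I J σ ∧
      τ ≤ poissonRate (hits I J σ) (I.card * J.card / Fintype.card α)).card : ℝ) ≤
      (Fintype.card α).factorial * (Fintype.card α * Real.exp (-τ)) := by
  set A := Finset.univ.filter fun σ : Equiv.Perm α => 1 ≤ hits I J σ ∧
      τ ≤ poissonRate (hits I J σ) (I.card * J.card / Fintype.card α) with hA
  have hmap : ∀ σ ∈ A, hits I J σ ∈ Finset.Icc 1 (Fintype.card α) := by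
    intro σ hσ
    rw [hA, Finset.mem_filter] at hσ
    exact Finset.mem_Icc.2 ⟨hσ.2.1, Finset.card_le_univ _⟩
  rw [Finset.card_eq_sum_card_fiberwise hmap]
  push_cast
  calc ∑ j ∈ Finset.Icc 1 (Fintype.card α), ((A.filter fun σ => hits I J σ = j).card : ℝ)
      ≤ ∑ j ∈ Finset.Icc 1 (Fintype.card α),
          (Fintype.card α).factorial * Real.exp (-τ) := by
        refine Finset.sum_le_sum fun j hj => ?_
        rcases (A.filter fun σ => hits I J σ = j).eq_empty_or_nonempty with he | ⟨σ, hσ⟩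
        · rw [he]; simp; positivity
        · rw [Finset.mem_filter, hA, Finset.mem_filter] at hσ
          obtain ⟨⟨-, -, hτ⟩, rfl⟩ := hσ
          refine le_trans ?_ ((card_hits_eq_le I J (Finset.mem_Icc.1 hj).1).trans ?_)
          · exact_mod_cast Finset.card_le_card
              (Finset.filter_subset_filter _ (Finset.subset_univ _))
          · gcongr
    _ = _ := by simp; ring

/-- From `j ≤ |I|` and `j ≤ |J|` one gets `j / m ≤ n / j`, and `log x ≤ x - 1` does the rest. This
deterministic cap disposes of levels above `2n`. -/
theorem poissonRate_hits_le [Nonempty α] (I J : Finset α) (σ : Equiv.Perm α)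
    (h : 1 ≤ hits I J σ) :
    poissonRate (hits I J σ) (I.card * J.card / Fintype.card α) ≤ 2 * Fintype.card α := by
  have hn : (0 : ℝ) < Fintype.card α := by exact_mod_cast Fintype.card_pos
  have hI : hits I J σ ≤ I.card := Finset.card_filter_le _ _
  have hJ : hits I J σ ≤ J.card := by
    rw [← card_filter_perm_mem J σ]
    exact Finset.card_le_card (Finset.filter_subset_filter _ (Finset.subset_univ _))
  have hIn : I.card ≤ Fintype.card α := Finset.card_le_univ _
  have hJn : J.card ≤ Fintype.card α := Finset.card_le_univ _
  rify at h hI hJ hIn hJn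
  generalize (hits I J σ : ℝ) = j at *
  generalize (Fintype.card α : ℝ) = n at *
  generalize (I.card : ℝ) = a at *
  generalize (J.card : ℝ) = c at *
  have hj : 0 < j := by linarith
  have ha : 0 < a := by linarith
  have hc : 0 < c := by linarith
  have hm : a * c / n ≤ n := by
    rw [div_le_iff₀ hn]; nlinarith
  have hlog : Real.log (j / (a * c / n)) ≤ n / j - 1 := by
    have : j / (a * c / n) ≤ n / j := by
      rw [div_div_eq_mul_div, div_le_div_iff₀ (by positivity) hj]
      nlinarith [mul_le_mul hI hJ hj.le ha.le]
    exact (Real.log_le_sub_one_of_pos (by positivity)).trans (by linarith)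
  have h2 : j * Real.log (j / (a * c / n)) ≤ n - j := by
    calc _ ≤ j * (n / j - 1) := by gcongr
      _ = n - j := by field_simp
  rw [poissonRate]
  linarith

end Permutations

/-! ### Permutation invariance of the sample law under independence -/

section Law

theorem eq_prod_of_mem_independenceClass {p q : ℕ} {P : Measure (JointSpace p q)}
    (hP : P ∈ IndependenceClass p q) :
    P = (P.map Prod.fst).prod (P.map Prod.snd) := by
  have := hP.1
  have h1 : IsProbabilityMeasure (P.map Prod.fst) :=
    Measure.isProbabilityMeasure_map measurable_fst.aemeasurable
  have h2 : IsProbabilityMeasure (P.map Prod.snd) :=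
    Measure.isProbabilityMeasure_map measurable_snd.aemeasurable
  refine (Measure.prod_eq fun s t hs ht => ?_).symm
  rw [hP.2 s t hs ht, Measure.map_apply measurable_fst hs, Measure.map_apply measurable_snd ht,
    Set.univ_prod, Set.prod_univ, mul_comm]

/-- The sample in which the `Y`-components are permuted by `σ`. -/
def recouple {p q n : ℕ} (σ : Equiv.Perm (Fin n)) (z : Fin n → JointSpace p q) :
    Fin n → JointSpace p q :=
  fun i => ((z i).1, (z (σ i)).2)

/-- Since `P` is a product, the sample law splits into the laws of the `X`-sample and the
`Y`-sample; the i.i.d. `Y`-sample is exchangeable. -/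
theorem measurePreserving_recouple {p q n : ℕ} {P : Measure (JointSpace p q)}
    (hP : P ∈ IndependenceClass p q) (σ : Equiv.Perm (Fin n)) :
    MeasurePreserving (recouple σ) (Measure.pi fun _ : Fin n => P)
      (Measure.pi fun _ : Fin n => P) := by
  have := hP.1
  have h1 : IsProbabilityMeasure (P.map Prod.fst) :=
    Measure.isProbabilityMeasure_map measurable_fst.aemeasurable
  have h2 : IsProbabilityMeasure (P.map Prod.snd) :=
    Measure.isProbabilityMeasure_map measurable_snd.aemeasurable
  have harr := measurePreserving_arrowProdEquivProdArrow (Fin p → ℝ) (Fin q → ℝ) (Fin n)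
    (fun _ => P.map Prod.fst) (fun _ => P.map Prod.snd)
  rw [← eq_prod_of_mem_independenceClass hP] at harr
  have hσ := measurePreserving_piCongrLeft (fun _ : Fin n => P.map Prod.snd) σ.symm
  have hmid := (MeasurePreserving.id (Measure.pi fun _ : Fin n => P.map Prod.fst)).prod hσ
  convert harr.symm.comp (hmid.comp harr) using 1
  funext z i
  have h : ∀ y : Fin n → Fin q → ℝ,
      MeasurableEquiv.piCongrLeft (fun _ => Fin q → ℝ) σ.symm y i = y (σ i) := by
    intro y
    simpa using MeasurableEquiv.piCongrLeft_apply_apply σ.symm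
      (β := fun _ => Fin q → ℝ) y (σ i)
  exact Prod.ext rfl (h fun i => (z i).2).symm

end Law

/-! ### Boxes with thresholds taken from the sample -/

section Grid

variable {m n : ℕ}

/-- Lower and upper thresholds of a box, in each coordinate either absent or given by the index
of a sample point. -/
abbrev GridIndex (m n : ℕ) : Type := (Fin m → Option (Fin n)) × (Fin m → Option (Fin n))

/-- The box whose thresholds are coordinates of the points `x`. -/
def gridBox (x : Fin n → Fin m → ℝ) (g : GridIndex m n) : Set (Fin m → ℝ) :=
  {u | ∀ j, (∀ i, g.1 j = some i → x i j < u j) ∧ (∀ i, g.2 j = some i → u j ≤ x i j)}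

open Classical in
/-- The indices of the points `x` in the grid box `g`. -/
noncomputable def gridIdx (x : Fin n → Fin m → ℝ) (g : GridIndex m n) : Finset (Fin n) :=
  Finset.univ.filter fun i => x i ∈ gridBox x g

theorem card_gridIndex : Fintype.card (GridIndex m n) = (n + 1) ^ (2 * m) := by
  simp [← pow_add, two_mul]

/-- Permuting the points only relabels the thresholds, so the family of boxes is permutation
invariant. -/
theorem gridBox_comp_perm (x : Fin n → Fin m → ℝ) (σ : Equiv.Perm (Fin n))
    (g : GridIndex m n) :
    gridBox (x ∘ σ) g =
      gridBox x (fun j => (g.1 j).map σ, fun j => (g.2 j).map σ) := by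
  ext u
  simp [gridBox]

theorem measurableSet_mem_gridBox {β : Type*} [MeasurableSpace β]
    {f : β → Fin n → Fin m → ℝ} (hf : Measurable f) (g : GridIndex m n) (i : Fin n) :
    MeasurableSet {z | f z i ∈ gridBox (f z) g} := by
  have hc : ∀ i j, Measurable fun z => f z i j := fun i j =>
    (measurable_pi_apply j).comp ((measurable_pi_apply i).comp hf)
  have : {z | f z i ∈ gridBox (f z) g} = ⋂ j,
      ((⋂ i', ⋂ (_ : g.1 j = some i'), {z | f z i' j < f z i j}) ∩
        ⋂ i', ⋂ (_ : g.2 j = some i'), {z | f z i j ≤ f z i' j}) := by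
    ext z; simp [gridBox]
  rw [this]
  exact MeasurableSet.iInter fun j =>
    (MeasurableSet.iInter fun i' => MeasurableSet.iInter fun _ =>
      measurableSet_lt (hc i' j) (hc i j)).inter
    (MeasurableSet.iInter fun i' => MeasurableSet.iInter fun _ =>
      measurableSet_le (hc i j) (hc i' j))

theorem measurableSet_gridIdx_eq {β : Type*} [MeasurableSpace β]
    {f : β → Fin n → Fin m → ℝ} (hf : Measurable f) (g : GridIndex m n) (I : Finset (Fin n)) :
    MeasurableSet {z | gridIdx (f z) g = I} := by
  have : {z | gridIdx (f z) g = I} = ⋂ i, {z | f z i ∈ gridBox (f z) g ↔ i ∈ I} := by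
    ext z; simp [gridIdx, Finset.ext_iff]
  rw [this]
  exact MeasurableSet.iInter fun i =>
    (measurableSet_mem_gridBox hf g i).iff (MeasurableSet.const _)

end Grid

/-! ### Uniform deviation bound over grid boxes -/

section Deviation

variable {p q n : ℕ}

/-- The `X`-components of a sample. -/
def fstSample (z : Fin n → JointSpace p q) : Fin n → Fin p → ℝ := fun i => (z i).1

/-- The `Y`-components of a sample. -/
def sndSample (z : Fin n → JointSpace p q) : Fin n → Fin q → ℝ := fun i => (z i).2

/-- The samples for which the number of points in some product of grid boxes deviates from its
mean under independent coupling with Chernoff exponent at least `τ`. -/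
def gridDeviation (p q n : ℕ) (τ : ℝ) : Set (Fin n → JointSpace p q) :=
  {z | ∃ (g : GridIndex p n) (h : GridIndex q n),
    1 ≤ (gridIdx (fstSample z) g ∩ gridIdx (sndSample z) h).card ∧
    τ ≤ poissonRate (gridIdx (fstSample z) g ∩ gridIdx (sndSample z) h).card
      ((gridIdx (fstSample z) g).card * (gridIdx (sndSample z) h).card / n)}

theorem measurable_fstSample : Measurable (fstSample (p := p) (q := q) (n := n)) :=
  measurable_pi_lambda _ fun i => measurable_fst.comp (measurable_pi_apply i)

theorem measurable_sndSample : Measurable (sndSample (p := p) (q := q) (n := n)) :=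
  measurable_pi_lambda _ fun i => measurable_snd.comp (measurable_pi_apply i)

/-- The tree rules are arbitrary and may be nonmeasurable; this event is the measurable set that
encloses their failures. It depends only on finitely many index-set configurations. -/
theorem measurableSet_gridDeviation (τ : ℝ) : MeasurableSet (gridDeviation p q n τ) := by
  have : gridDeviation p q n τ = ⋃ (g : GridIndex p n) (h : GridIndex q n)
      (I : Finset (Fin n)) (J : Finset (Fin n)) (_ : 1 ≤ (I ∩ J).card ∧
        τ ≤ poissonRate (I ∩ J).card (I.card * J.card / n)),
      {z | gridIdx (fstSample z) g = I} ∩ {z | gridIdx (sndSample z) h = J} := by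
    ext z
    simp only [gridDeviation, Set.mem_ofPred_eq, Set.mem_iUnion, Set.mem_inter_iff, exists_prop]
    constructor
    · rintro ⟨g, h, H⟩
      exact ⟨g, h, _, _, H, rfl, rfl⟩
    · rintro ⟨g, h, I, J, H, rfl, rfl⟩
      exact ⟨g, h, H⟩
  rw [this]
  exact MeasurableSet.iUnion fun g => MeasurableSet.iUnion fun h => MeasurableSet.iUnion fun I =>
    MeasurableSet.iUnion fun J => MeasurableSet.iUnion fun _ =>
      (measurableSet_gridIdx_eq measurable_fstSample g I).inter
        (measurableSet_gridIdx_eq measurable_sndSample h J)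

theorem mem_gridDeviation_recouple {σ : Equiv.Perm (Fin n)} {z : Fin n → JointSpace p q} {τ : ℝ}
    (hz : recouple σ z ∈ gridDeviation p q n τ) :
    ∃ (g : GridIndex p n) (h : GridIndex q n),
      1 ≤ hits (gridIdx (fstSample z) g) (gridIdx (sndSample z) h) σ ∧
      τ ≤ poissonRate (hits (gridIdx (fstSample z) g) (gridIdx (sndSample z) h) σ)
        ((gridIdx (fstSample z) g).card * (gridIdx (sndSample z) h).card / Fintype.card (Fin n)) := by
  classical
  obtain ⟨g, h, H⟩ := hz
  refine ⟨g, (fun j => (h.1 j).map σ, fun j => (h.2 j).map σ), ?_⟩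
  set h' : GridIndex q n := (fun j => (h.1 j).map σ, fun j => (h.2 j).map σ) with hh'
  have hfst : fstSample (recouple σ z) = fstSample z := rfl
  have hsnd : sndSample (recouple σ z) = sndSample z ∘ σ := rfl
  have hJ : gridIdx (sndSample z ∘ σ) h =
      Finset.univ.filter fun i => σ i ∈ gridIdx (sndSample z) h' := by
    ext i
    simp [gridIdx, gridBox_comp_perm, ← hh']
  have hcard : (gridIdx (sndSample z ∘ σ) h).card = (gridIdx (sndSample z) h').card := by
    rw [hJ]; exact card_filter_perm_mem _ σ
  have hinter : gridIdx (fstSample z) g ∩ gridIdx (sndSample z ∘ σ) h =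
      (gridIdx (fstSample z) g).filter fun i => σ i ∈ gridIdx (sndSample z) h' := by
    rw [hJ]; ext i; simp
  rw [hfst, hsnd, hcard, hinter] at H
  rw [Fintype.card_fin]
  exact H

open Classical in
theorem card_recouple_mem_gridDeviation_le (hn : 1 ≤ n) (z : Fin n → JointSpace p q) (τ : ℝ) :
    ((Finset.univ.filter fun σ => recouple σ z ∈ gridDeviation p q n τ).card : ℝ) ≤
      n.factorial * ((n + 1 : ℝ) ^ (2 * (p + q)) * (n * Real.exp (-τ))) := by
  have : Nonempty (Fin n) := ⟨⟨0, hn⟩⟩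
  let B : GridIndex p n × GridIndex q n → Finset (Equiv.Perm (Fin n)) := fun gh =>
    Finset.univ.filter fun σ =>
      1 ≤ hits (gridIdx (fstSample z) gh.1) (gridIdx (sndSample z) gh.2) σ ∧
      τ ≤ poissonRate (hits (gridIdx (fstSample z) gh.1) (gridIdx (sndSample z) gh.2) σ)
        ((gridIdx (fstSample z) gh.1).card * (gridIdx (sndSample z) gh.2).card /
          Fintype.card (Fin n))
  have hsub : (Finset.univ.filter fun σ => recouple σ z ∈ gridDeviation p q n τ) ⊆
      Finset.univ.biUnion B := by
    intro σ hσ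
    obtain ⟨g, h, H⟩ := mem_gridDeviation_recouple (Finset.mem_filter.1 hσ).2
    exact Finset.mem_biUnion.2 ⟨(g, h), Finset.mem_univ _,
      Finset.mem_filter.2 ⟨Finset.mem_univ _, H⟩⟩
  have h1 : ((Finset.univ.filter fun σ => recouple σ z ∈ gridDeviation p q n τ).card : ℝ) ≤
      ∑ gh, ((B gh).card : ℝ) := by
    exact_mod_cast (Finset.card_le_card hsub).trans Finset.card_biUnion_le
  have hcard : (Fintype.card (GridIndex p n × GridIndex q n) : ℝ) =
      (n + 1 : ℝ) ^ (2 * (p + q)) := by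
    rw [Fintype.card_prod, card_gridIndex, card_gridIndex]
    push_cast
    ring
  calc _ ≤ ∑ gh, ((B gh).card : ℝ) := h1
    _ ≤ ∑ _gh : GridIndex p n × GridIndex q n,
        (n.factorial * (n * Real.exp (-τ)) : ℝ) := by
        refine Finset.sum_le_sum fun gh _ => ?_
        have := card_poissonRate_hits_ge_le (gridIdx (fstSample z) gh.1)
          (gridIdx (sndSample z) gh.2) τ
        simpa [B] using this
    _ = _ := by
        rw [Finset.sum_const, nsmul_eq_mul, Finset.card_univ, hcard]
        ring

/-- By invariance, `n!` times the probability is the integral of the number of permutations that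
lead into the event, and that number is bounded for every fixed sample. -/
theorem measure_gridDeviation_le {P : Measure (JointSpace p q)}
    (hP : P ∈ IndependenceClass p q) (hn : 1 ≤ n) (τ : ℝ) :
    (Measure.pi fun _ : Fin n => P) (gridDeviation p q n τ) ≤
      ENNReal.ofReal ((n + 1 : ℝ) ^ (2 * (p + q)) * (n * Real.exp (-τ))) := by
  classical
  have := hP.1
  set ν := Measure.pi fun _ : Fin n => P
  set E := gridDeviation p q n τ
  set B : ℝ := (n + 1 : ℝ) ^ (2 * (p + q)) * (n * Real.exp (-τ))
  have hE : MeasurableSet E := measurableSet_gridDeviation τ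
  have hmul : (n.factorial : ENNReal) * ν E ≤ n.factorial * ENNReal.ofReal B := by
    calc (n.factorial : ENNReal) * ν E = ∑ σ : Equiv.Perm (Fin n), ν (recouple σ ⁻¹' E) := by
          simp [(measurePreserving_recouple hP _).measure_preimage hE.nullMeasurableSet, ν,
            Fintype.card_perm]
      _ = ∑ σ : Equiv.Perm (Fin n), ∫⁻ z, (recouple σ ⁻¹' E).indicator 1 z ∂ν := by
          refine Finset.sum_congr rfl fun σ _ => ?_
          rw [lintegral_indicator_one ((measurePreserving_recouple hP σ).measurable hE)]
      _ = ∫⁻ z, ∑ σ : Equiv.Perm (Fin n), (recouple σ ⁻¹' E).indicator 1 z ∂ν := by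
          rw [lintegral_finsetSum]
          exact fun σ _ => measurable_one.indicator
            ((measurePreserving_recouple hP σ).measurable hE)
      _ ≤ ∫⁻ _z, n.factorial * ENNReal.ofReal B ∂ν := by
          refine lintegral_mono fun z => ?_
          have h1 : ∑ σ : Equiv.Perm (Fin n),
              (recouple σ ⁻¹' E).indicator (1 : (Fin n → JointSpace p q) → ENNReal) z =
              ((Finset.univ.filter fun σ => recouple σ z ∈ E).card : ENNReal) := by
            simp [Set.indicator_apply]
          refine h1.trans_le ?_
          rw [← ENNReal.ofReal_natCast, ← ENNReal.ofReal_natCast n.factorial,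
            ← ENNReal.ofReal_mul (by positivity)]
          exact ENNReal.ofReal_le_ofReal (card_recouple_mem_gridDeviation_le hn z τ)
      _ = n.factorial * ENNReal.ofReal B := by simp [ν]
  exact (ENNReal.mul_le_mul_iff_right (by exact_mod_cast n.factorial_ne_zero)
    (ENNReal.natCast_ne_top _)).1 hmul

theorem gridDeviation_eq_empty (hn : 1 ≤ n) {τ : ℝ} (hτ : 2 * n < τ) :
    gridDeviation p q n τ = ∅ := by
  have : Nonempty (Fin n) := ⟨⟨0, hn⟩⟩
  rw [Set.eq_empty_iff_forall_notMem]
  rintro z hz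
  -- The identity permutation turns the box count into a number of hits, so the cap on the rate
  -- applies.
  have hz' : recouple 1 z ∈ gridDeviation p q n τ := hz
  obtain ⟨g, h, h1, h2⟩ := mem_gridDeviation_recouple hz'
  have := poissonRate_hits_le _ _ _ h1
  rw [Fintype.card_fin] at *
  linarith

end Deviation

/-! ### Tree cells as grid boxes, and the divergence of an optimal tree -/

section Cells

variable {p q n : ℕ}

theorem exists_cellMedian_eq (z : Fin n → JointSpace p q) (c : Coord p q)
    {A : Set (JointSpace p q)} (hA : ∃ i, z i ∈ A) :
    ∃ i, z i ∈ A ∧ cellMedian z c A = coordVal c (z i) := by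
  classical
  obtain ⟨i₀, hi₀⟩ := hA
  set s : List ℝ :=
    ((Finset.univ.filter fun i => z i ∈ A).val.map fun i => coordVal c (z i)).sort (· ≤ ·)
    with hs
  have hmem : ∀ t, t ∈ s ↔ ∃ i, z i ∈ A ∧ coordVal c (z i) = t := by
    intro t; simp [hs]
  -- Nonemptiness puts the median index in range, so the default value 0 of `getD` never occurs.
  have hpos : 0 < s.length := List.length_pos_of_mem ((hmem _).2 ⟨i₀, hi₀, rfl⟩)
  have hlt : (s.length - 1) / 2 < s.length := by omega
  obtain ⟨i, hi, h⟩ := (hmem _).1 (List.getElem_mem hlt)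
  refine ⟨i, hi, ?_⟩
  rw [h, ← List.getD_eq_getElem _ 0 hlt, hs]
  rw [cellMedian]

/-- Because `x i₀` lies in the box, the cut at its coordinate is at least as strict as the old
threshold on that side and can simply overwrite it. -/
theorem exists_gridBox_eq_inter_halfLine {m : ℕ} (x : Fin n → Fin m → ℝ) (g : GridIndex m n)
    (j : Fin m) (i₀ : Fin n) (h : x i₀ ∈ gridBox x g) (s : Bool) :
    ∃ g', gridBox x g ∩ {u | u j ∈ halfLine (x i₀ j) s} = gridBox x g' := by
  cases s with
  | false =>
    refine ⟨(g.1, Function.update g.2 j (some i₀)), ?_⟩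
    ext u
    constructor
    · rintro ⟨hu, hj⟩ j'
      refine ⟨(hu j').1, fun i hi => ?_⟩
      by_cases hjj : j' = j
      · subst hjj
        simp only [Function.update_self, Option.some.injEq] at hi
        subst hi
        exact hj
      · simp only [Function.update_of_ne hjj] at hi
        exact (hu j').2 i hi
    · intro hu
      have hj : u j ≤ x i₀ j := (hu j).2 i₀ (by simp)
      refine ⟨fun j' => ⟨(hu j').1, fun i hi => ?_⟩, hj⟩
      by_cases hjj : j' = j
      · subst hjj
        exact hj.trans ((h j').2 i hi)
      · exact (hu j').2 i (by simpa [Function.update_of_ne hjj] using hi)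
  | true =>
    refine ⟨(Function.update g.1 j (some i₀), g.2), ?_⟩
    ext u
    constructor
    · rintro ⟨hu, hj⟩ j'
      refine ⟨fun i hi => ?_, (hu j').2⟩
      by_cases hjj : j' = j
      · subst hjj
        simp only [Function.update_self, Option.some.injEq] at hi
        subst hi
        exact hj
      · simp only [Function.update_of_ne hjj] at hi
        exact (hu j').1 i hi
    · intro hu
      have hj : x i₀ j < u j := (hu j).1 i₀ (by simp)
      refine ⟨fun j' => ⟨fun i hi => ?_, (hu j').2⟩, hj⟩
      by_cases hjj : j' = j
      · subst hjj
        exact ((h j').1 i hi).trans hj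
      · exact (hu j').1 i (by simpa [Function.update_of_ne hjj] using hi)

theorem splitCell_toSet_subset (c : Coord p q) (t : ℝ) (s : Bool) (A : ProdCell p q) :
    (splitCell c t s A).toSet ⊆ A.toSet := by
  cases c with
  | inl j => exact Set.prod_mono_left Set.inter_subset_left
  | inr j => exact Set.prod_mono_right Set.inter_subset_left

theorem exists_mem_of_empProb_pos (z : Fin n → JointSpace p q) {A : Set (JointSpace p q)}
    (h : 0 < empProb z A) : ∃ i, z i ∈ A := by
  classical
  by_contra! hc
  simp [empProb, hc] at h

/-- A kept split has children of mass at least `b > 0`, so the parent contains sample points and its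
median is a coordinate of one of them. -/
theorem exists_cell_eq_gridBox (z : Fin n → JointSpace p q) (axis : Node → Coord p q) {b : ℝ}
    (hb : 0 < b) (v : Node) (hv : InFullTree z axis b v) :
    ∃ (g : GridIndex p n) (h : GridIndex q n),
      cell z axis v = (gridBox (fstSample z) g, gridBox (sndSample z) h) := by
  induction v with
  | nil =>
    refine ⟨(fun _ => none, fun _ => none), (fun _ => none, fun _ => none), ?_⟩
    simp [cell, gridBox]
  | cons s v ih =>
    obtain ⟨g, h, hgh⟩ := ih hv.1
    obtain ⟨i₁, hi₁⟩ := exists_mem_of_empProb_pos z (hb.trans_le (hv.2 s))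
    have hi₁' : z i₁ ∈ (cell z axis v).toSet := splitCell_toSet_subset _ _ _ _ hi₁
    obtain ⟨i, hi, hmed⟩ := exists_cellMedian_eq z (axis v) ⟨i₁, hi₁'⟩
    rw [cell, hmed]
    rw [hgh] at hi ⊢
    obtain ⟨hX, hY⟩ := hi
    cases axis v with
    | inl j =>
      obtain ⟨g', hg'⟩ := exists_gridBox_eq_inter_halfLine (fstSample z) g j i hX s
      exact ⟨g', h, Prod.ext hg' rfl⟩
    | inr j =>
      obtain ⟨h', hh'⟩ := exists_gridBox_eq_inter_halfLine (sndSample z) h j i hY s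
      exact ⟨g, h', Prod.ext rfl hh'⟩

theorem empProb_eq_add (z : Fin n → JointSpace p q) {A A₁ A₂ : Set (JointSpace p q)}
    (h : ∀ u, u ∈ A ↔ (u ∈ A₁ ∨ u ∈ A₂)) (hd : ∀ u, u ∈ A₁ → u ∉ A₂) :
    empProb z A = empProb z A₁ + empProb z A₂ := by
  classical
  simp only [empProb]
  rw [← add_div, ← Nat.cast_add, ← Finset.card_union_of_disjoint]
  · refine congrArg (fun s : Finset (Fin n) => (s.card : ℝ) / n) ?_
    ext i
    simp [h]
  · rw [Finset.disjoint_left]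
    intro i
    simpa using hd (z i)

theorem empProb_splitCell (z : Fin n → JointSpace p q) (c : Coord p q) (t : ℝ)
    (A : ProdCell p q) :
    empProb z A.toSet =
      empProb z (splitCell c t false A).toSet + empProb z (splitCell c t true A).toSet := by
  apply empProb_eq_add
  · intro u
    cases c with
    | inl j => simp [ProdCell.toSet, splitCell, halfLine]; grind
    | inr j => simp [ProdCell.toSet, splitCell, halfLine]; grind
  · intro u
    cases c with
    | inl j => simp [ProdCell.toSet, splitCell, halfLine]; grind
    | inr j => simp [ProdCell.toSet, splitCell, halfLine]; grind

theorem empProdProb_splitCell (z : Fin n → JointSpace p q) (c : Coord p q) (t : ℝ)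
    (A : ProdCell p q) :
    empProdProb z A =
      empProdProb z (splitCell c t false A) + empProdProb z (splitCell c t true A) := by
  cases c with
  | inl j =>
    have h := empProb_splitCell z (Sum.inl j) t (A.1, Set.univ)
    simp only [empProdProb, splitCell, ProdCell.toSet] at h ⊢
    rw [h, add_mul]
  | inr j =>
    have h := empProb_splitCell z (Sum.inr j) t (Set.univ, A.2)
    simp only [empProdProb, splitCell, ProdCell.toSet] at h ⊢
    rw [h, mul_add]

theorem sum_map_leavesFrom {f : Node → ℝ} (hf : ∀ v, f v = f (false :: v) + f (true :: v))
    (T : BinTree) (v : Node) : ((T.leavesFrom v).map f).sum = f v := by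
  induction T generalizing v with
  | leaf => simp [BinTree.leavesFrom]
  | node l r ihl ihr => simp [BinTree.leavesFrom, ihl, ihr, ← hf]

theorem leavesFrom_subset_nodesFrom (T : BinTree) (v : Node) :
    T.leavesFrom v ⊆ T.nodesFrom v := by
  induction T generalizing v with
  | leaf => simp [BinTree.leavesFrom, BinTree.nodesFrom]
  | node l r ihl ihr =>
    intro u hu
    rw [BinTree.leavesFrom, List.mem_append] at hu
    rw [BinTree.nodesFrom, List.mem_cons, List.mem_append]
    exact Or.inr (hu.imp (fun h => ihl _ h) (fun h => ihr _ h))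

theorem ne_nil_of_mem_leavesFrom (T : BinTree) {u v : Node} (hv : v ≠ [])
    (hu : u ∈ T.leavesFrom v) : u ≠ [] := by
  induction T generalizing v with
  | leaf => simpa [BinTree.leavesFrom, List.mem_singleton.1 hu] using hv
  | node l r ihl ihr =>
    rw [BinTree.leavesFrom, List.mem_append] at hu
    exact hu.elim (fun h => ihl (List.cons_ne_nil _ _) h) (fun h => ihr (List.cons_ne_nil _ _) h)

theorem size_leaf : BinTree.leaf.size = 1 := rfl

theorem ne_nil_of_mem_leaves {T : BinTree} (hT : 1 < T.size) {u : Node} (hu : u ∈ T.leaves) :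
    u ≠ [] := by
  cases T with
  | leaf => simp [size_leaf] at hT
  | node l r =>
    rw [BinTree.leaves, BinTree.leavesFrom, List.mem_append] at hu
    exact hu.elim (fun h => ne_nil_of_mem_leavesFrom l (List.cons_ne_nil _ _) h)
      (fun h => ne_nil_of_mem_leavesFrom r (List.cons_ne_nil _ _) h)

theorem le_empProb_of_mem_leaves {z : Fin n → JointSpace p q} {axis : Node → Coord p q} {b : ℝ}
    {T : BinTree} (hT : IsPruned z axis b T) (hsize : 1 < T.size) {u : Node}
    (hu : u ∈ T.leaves) : b ≤ empProb z (cell z axis u).toSet := by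
  have h := hT u (leavesFrom_subset_nodesFrom T [] hu)
  obtain ⟨s, v, rfl⟩ := List.exists_cons_of_ne_nil (ne_nil_of_mem_leaves hsize hu)
  exact h.2 s

theorem empProb_univ (hn : 1 ≤ n) (z : Fin n → JointSpace p q) :
    empProb z Set.univ = 1 := by
  have : (n : ℝ) ≠ 0 := by positivity
  simp [empProb, this]

theorem sum_empProb_leaves (hn : 1 ≤ n) (z : Fin n → JointSpace p q) (axis : Node → Coord p q)
    (T : BinTree) : (T.leaves.map fun v => empProb z (cell z axis v).toSet).sum = 1 := by
  rw [BinTree.leaves, sum_map_leavesFrom (f := fun v => empProb z (cell z axis v).toSet)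
    (fun v => empProb_splitCell z (axis v) (cellMedian z (axis v) (cell z axis v).toSet)
      (cell z axis v)) T []]
  simp [cell, ProdCell.toSet, empProb_univ hn]

theorem sum_empProdProb_leaves (hn : 1 ≤ n) (z : Fin n → JointSpace p q)
    (axis : Node → Coord p q) (T : BinTree) :
    (T.leaves.map fun v => empProdProb z (cell z axis v)).sum = 1 := by
  rw [BinTree.leaves, sum_map_leavesFrom (f := fun v => empProdProb z (cell z axis v))
    (fun v => empProdProb_splitCell z (axis v) (cellMedian z (axis v) (cell z axis v).toSet)
      (cell z axis v)) T []]
  simp [cell, empProdProb, empProb_univ hn]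

theorem sum_map_poissonRate {ι : Type*} (L : List ι) (f g : ι → ℝ) :
    (L.map fun v => poissonRate (f v) (g v)).sum =
      (L.map fun v => f v * Real.log (f v / g v)).sum - (L.map f).sum + (L.map g).sum := by
  induction L with
  | nil => simp
  | cons a L ih =>
    simp only [List.map_cons, List.sum_cons]
    rw [ih, poissonRate]
    ring

/-- The linear terms of `poissonRate` cancel, as the leaf masses sum to 1 under both empirical laws.
-/
theorem empDivergence_eq_sum_poissonRate (hn : 1 ≤ n) (z : Fin n → JointSpace p q)
    (axis : Node → Coord p q) (T : BinTree) :
    empDivergence z axis T = (T.leaves.map fun v =>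
      poissonRate (empProb z (cell z axis v).toSet) (empProdProb z (cell z axis v))).sum := by
  rw [sum_map_poissonRate, sum_empProb_leaves hn, sum_empProdProb_leaves hn, empDivergence]
  ring

theorem objective_leaf (hn : 1 ≤ n) (z : Fin n → JointSpace p q) (axis : Node → Coord p q)
    (b δ : ℝ) : objective z axis b δ BinTree.leaf = 0 := by
  simp [objective, empDivergence, penalty, size_leaf, BinTree.leaves, BinTree.leavesFrom, cell,
    ProdCell.toSet, empProdProb, empProb_univ hn]

theorem isPruned_leaf (z : Fin n → JointSpace p q) (axis : Node → Coord p q) (b : ℝ) :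
    IsPruned z axis b BinTree.leaf := by
  intro v hv
  rw [BinTree.nodes, BinTree.nodesFrom, List.mem_singleton] at hv
  subst hv
  trivial

theorem penalty_le_empDivergence (hn : 1 ≤ n) {z : Fin n → JointSpace p q}
    {axis : Node → Coord p q} {b δ : ℝ} {T : BinTree} (hT : IsOptimalTree z axis b δ T) :
    penalty n b (p + q) δ T.size ≤ empDivergence z axis T := by
  have h := hT.2 _ (isPruned_leaf z axis b)
  rw [objective_leaf hn, objective] at h
  linarith

theorem size_mul_le_one (hn : 1 ≤ n) {z : Fin n → JointSpace p q}
    {axis : Node → Coord p q} {b : ℝ} {T : BinTree} (hT : IsPruned z axis b T)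
    (hsize : 1 < T.size) : T.size * b ≤ 1 := by
  rw [← sum_empProb_leaves hn z axis T, BinTree.size, ← nsmul_eq_mul,
    ← List.length_map (fun v => empProb z (cell z axis v).toSet)]
  apply List.card_nsmul_le_sum
  intro x hx
  obtain ⟨u, hu, rfl⟩ := List.mem_map.1 hx
  exact le_empProb_of_mem_leaves hT hsize hu

/-- The complexity term of the penalty of a tree with two leaves, without its confidence part. -/
noncomputable def baseComplexity (d n : ℕ) : ℝ :=
  Real.log 8 + 2 * ((d + 1) * Real.log 2 + d * Real.log n)

/-- A lower bound for `n` times the penalty per leaf. -/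
noncomputable def deviationLevel (d n : ℕ) : ℝ :=
  24 * √2 * √(n : ℝ) * √(baseComplexity d n)

/-- The factor `1/b ≥ k` pays for one level per leaf. Under the root, `δ b ≤ 1` and `k ≥ 2` leave
`baseComplexity` as a bound free of `b`, `δ` and `k`. -/
theorem deviationLevel_mul_le_penalty {d k : ℕ} {b δ : ℝ} (hn : 1 ≤ n) (hb : b ∈ Set.Ioo (0 : ℝ) 1)
    (hδ : δ ∈ Set.Ioo (0 : ℝ) 1) (hk : 2 ≤ k) (hkb : k * b ≤ 1) :
    k * (deviationLevel d n / n) ≤ penalty n b d δ k := by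
  obtain ⟨hb0, hb1⟩ := hb
  obtain ⟨hδ0, hδ1⟩ := hδ
  have hn0 : (0 : ℝ) < n := by exact_mod_cast hn
  have hlogn : 0 ≤ Real.log n := Real.log_natCast_nonneg n
  have hlog2 : 0 ≤ Real.log 2 := Real.log_nonneg one_le_two
  have hk2 : (2 : ℝ) ≤ k := by exact_mod_cast hk
  rw [penalty, if_neg (by omega), confRadius]
  have h8 : Real.log 8 ≤ Real.log (8 / (δ * b)) := by
    apply Real.log_le_log (by norm_num)
    rw [le_div_iff₀ (by positivity)]
    nlinarith [mul_le_one₀ hδ1.le hb0.le hb1.le]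
  have hs : baseComplexity d n ≤
      Real.log (8 / (δ * b)) + k * ((d + 1) * Real.log 2 + d * Real.log n) := by
    rw [baseComplexity]
    gcongr
  have hsq : √(n : ℝ) * √(n : ℝ) = n := Real.mul_self_sqrt hn0.le
  have hsn : 0 < √(n : ℝ) := Real.sqrt_pos.2 hn0
  have heq : k * (deviationLevel d n / n) = k * (24 * √2 / √n * √(baseComplexity d n)) := by
    rw [deviationLevel]
    nth_rewrite 2 [← hsq]
    field_simp
  rw [heq, ← mul_assoc]
  gcongr
  rw [le_div_iff₀ (by positivity)]
  calc (k : ℝ) * (24 * √2 / √n) * (b * √n) = (k * b) * (24 * √2) := by field_simp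
    _ ≤ 1 * (24 * √2) := by gcongr
    _ = _ := one_mul _

theorem mem_gridIdx {m : ℕ} {x : Fin n → Fin m → ℝ} {g : GridIndex m n} {i : Fin n} :
    i ∈ gridIdx x g ↔ x i ∈ gridBox x g := by
  simp [gridIdx]

theorem card_eq_mul_empProb (hn : 1 ≤ n) {z : Fin n → JointSpace p q} {I : Finset (Fin n)}
    {A : Set (JointSpace p q)} (h : ∀ i, i ∈ I ↔ z i ∈ A) : (I.card : ℝ) = n * empProb z A := by
  classical
  have hn0 : (n : ℝ) ≠ 0 := by positivity
  rw [empProb, mul_div_cancel₀ _ hn0]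
  refine congrArg (fun s : Finset (Fin n) => (s.card : ℝ)) ?_
  ext i
  simp [h]

theorem card_gridIdx_eq {z : Fin n → JointSpace p q} (g : GridIndex p n) (h : GridIndex q n)
    (hn : 1 ≤ n) :
    ((gridIdx (fstSample z) g).card : ℝ) = n * empProb z (gridBox (fstSample z) g ×ˢ Set.univ) ∧
    ((gridIdx (sndSample z) h).card : ℝ) = n * empProb z (Set.univ ×ˢ gridBox (sndSample z) h) ∧
    ((gridIdx (fstSample z) g ∩ gridIdx (sndSample z) h).card : ℝ) =
      n * empProb z (gridBox (fstSample z) g ×ˢ gridBox (sndSample z) h) := by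
  refine ⟨card_eq_mul_empProb hn fun i => ?_, card_eq_mul_empProb hn fun i => ?_,
    card_eq_mul_empProb hn fun i => ?_⟩ <;> simp [mem_gridIdx, fstSample, sndSample]

theorem poissonRate_mul {c : ℝ} (hc : c ≠ 0) (j m : ℝ) :
    poissonRate (c * j) (c * m) = c * poissonRate j m := by
  rw [poissonRate, poissonRate, mul_div_mul_left _ _ hc]
  ring

/-- Pigeonhole over the leaves, followed by homogeneity of `poissonRate` to pass from frequencies to
counts. -/
theorem mem_gridDeviation_of_one_lt_size (hn : 1 ≤ n) {z : Fin n → JointSpace p q}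
    {axis : Node → Coord p q} {b δ : ℝ} (hb : b ∈ Set.Ioo (0 : ℝ) 1)
    (hδ : δ ∈ Set.Ioo (0 : ℝ) 1) {T : BinTree} (hT : IsOptimalTree z axis b δ T)
    (hsize : 1 < T.size) : z ∈ gridDeviation p q n (deviationLevel (p + q) n) := by
  classical
  have hn0 : (0 : ℝ) < n := by exact_mod_cast hn
  have h1 := (deviationLevel_mul_le_penalty (d := p + q) hn hb hδ hsize
    (size_mul_le_one hn hT.1 hsize)).trans (penalty_le_empDivergence hn hT)
  rw [empDivergence_eq_sum_poissonRate hn] at h1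
  have hne : T.leaves ≠ [] := by
    rintro h; simp [BinTree.size, h] at hsize
  obtain ⟨v, hv, hle⟩ : ∃ v ∈ T.leaves, deviationLevel (p + q) n / n ≤
      poissonRate (empProb z (cell z axis v).toSet) (empProdProb z (cell z axis v)) := by
    apply List.exists_le_of_sum_le hne
    simpa [BinTree.size] using h1
  have hpos : 0 < empProb z (cell z axis v).toSet :=
    hb.1.trans_le (le_empProb_of_mem_leaves hT.1 hsize hv)
  obtain ⟨g, h, hgh⟩ := exists_cell_eq_gridBox z axis hb.1 v
    (hT.1 v (leavesFrom_subset_nodesFrom T [] hv))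
  rw [hgh] at hle hpos
  simp only [ProdCell.toSet, empProdProb] at hle hpos
  obtain ⟨hI, hJ, hIJ⟩ := card_gridIdx_eq (z := z) g h hn
  refine ⟨g, h, ?_, ?_⟩
  · have : (0 : ℝ) < (gridIdx (fstSample z) g ∩ gridIdx (sndSample z) h).card := by
      rw [hIJ]; positivity
    exact_mod_cast this
  · rw [hI, hJ, hIJ]
    have hm : ∀ x y : ℝ, n * x * (n * y) / n = n * (x * y) := by
      intro x y; field_simp
    rw [hm, poissonRate_mul hn0.ne', ← div_le_iff₀' hn0]
    exact hle

end Cells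

/-! ### Tail of the collapse time -/

section Tail

variable {p q n : ℕ}

theorem one_le_baseComplexity (d n : ℕ) : 1 ≤ baseComplexity d n := by
  have h8 : 1 ≤ Real.log 8 := by
    rw [Real.le_log_iff_exp_le (by norm_num)]
    exact Real.exp_one_lt_d9.le.trans (by norm_num)
  have hlogn : 0 ≤ Real.log n := Real.log_natCast_nonneg n
  have hlog2 : 0 ≤ Real.log 2 := Real.log_nonneg one_le_two
  have : 0 ≤ 2 * (((d : ℝ) + 1) * Real.log 2 + d * Real.log n) := by positivity
  rw [baseComplexity]
  linarith

theorem pow_le_exp_baseComplexity (hn : 1 ≤ n) (d : ℕ) :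
    (n + 1 : ℝ) ^ (2 * d) ≤ Real.exp (baseComplexity d n) := by
  have hn1 : (1 : ℝ) ≤ n := by exact_mod_cast hn
  have hlog2 : 0 ≤ Real.log 2 := Real.log_nonneg one_le_two
  have hlog8 : 0 ≤ Real.log 8 := Real.log_nonneg (by norm_num)
  calc (n + 1 : ℝ) ^ (2 * d) ≤ (2 * n : ℝ) ^ (2 * d) := by gcongr; linarith
    _ = Real.exp ((2 * d : ℕ) * (Real.log 2 + Real.log n)) := by
      rw [Real.exp_nat_mul, ← Real.log_mul (by norm_num) (by positivity),
        Real.exp_log (by positivity)]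
    _ ≤ _ := by
      rw [Real.exp_le_exp, baseComplexity]
      push_cast
      nlinarith

/-- With `s` the base complexity and level `τ ≥ 24 √n √s`, only `τ ≤ 2n` matters. That forces `√s ≤
√n`, so the entropy `s ≤ √n √s` is absorbed by `τ`. What remains beats `e^(-n^(1/3) - 6√n)`, and
`e^(6√n) ≥ n³` turns the spare factor `n` into `1/n²`. -/
theorem measure_gridDeviation_deviationLevel_le {P : Measure (JointSpace p q)}
    (hP : P ∈ IndependenceClass p q) (hn : 1 ≤ n) :
    (Measure.pi fun _ : Fin n => P) (gridDeviation p q n (deviationLevel (p + q) n)) ≤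
      ENNReal.ofReal (Real.exp (-((n : ℝ) ^ (1 / 3 : ℝ))) * (1 / (n : ℝ) ^ 2)) := by
  rcases lt_or_ge (2 * n : ℝ) (deviationLevel (p + q) n) with hτ | hτ
  · rw [gridDeviation_eq_empty hn hτ]
    simp
  refine (measure_gridDeviation_le hP hn _).trans (ENNReal.ofReal_le_ofReal ?_)
  have hn1 : (1 : ℝ) ≤ n := by exact_mod_cast hn
  set s := baseComplexity (p + q) n
  have hs1 : 1 ≤ √s := Real.one_le_sqrt.2 (one_le_baseComplexity _ _)
  have hss : √s * √s = s :=
    Real.mul_self_sqrt (zero_le_one.trans (one_le_baseComplexity _ _))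
  have hu1 : 1 ≤ √(n : ℝ) := Real.one_le_sqrt.2 hn1
  have huu : √(n : ℝ) * √(n : ℝ) = n := Real.mul_self_sqrt (by positivity)
  have h2 : 1 ≤ √(2 : ℝ) := Real.one_le_sqrt.2 one_le_two
  have hroot : (n : ℝ) ^ (1 / 3 : ℝ) ≤ √(n : ℝ) := by
    rw [Real.sqrt_eq_rpow]
    exact Real.rpow_le_rpow_of_exponent_le hn1 (by norm_num)
  have hlow : 24 * (√(n : ℝ) * √s) ≤ deviationLevel (p + q) n := by
    change _ ≤ 24 * √2 * √(n : ℝ) * √s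
    have : 0 ≤ √(n : ℝ) * √s := by positivity
    nlinarith
  have hsu : √s ≤ √(n : ℝ) := by
    have h3 : 24 * (√(n : ℝ) * √s) ≤ 2 * (√(n : ℝ) * √(n : ℝ)) := by
      rw [huu]; exact hlow.trans hτ
    nlinarith
  have hexp : s - deviationLevel (p + q) n ≤
      -((n : ℝ) ^ (1 / 3 : ℝ)) - 6 * √(n : ℝ) := by
    have h3 : s ≤ √(n : ℝ) * √s := by
      nth_rewrite 1 [← hss]; gcongr
    have h4 : √(n : ℝ) ≤ √(n : ℝ) * √s := le_mul_of_one_le_right (by positivity) hs1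
    linarith
  have hcube : (n : ℝ) ^ 3 ≤ Real.exp (6 * √(n : ℝ)) := by
    calc (n : ℝ) ^ 3 = √(n : ℝ) ^ 6 := by nth_rewrite 1 [← huu]; ring
      _ ≤ Real.exp (√(n : ℝ)) ^ 6 := by
        gcongr
        linarith [Real.add_one_le_exp √(n : ℝ)]
      _ = _ := by rw [← Real.exp_nat_mul]; norm_num
  calc (n + 1 : ℝ) ^ (2 * (p + q)) * (n * Real.exp (-deviationLevel (p + q) n))
      ≤ Real.exp s * (n * Real.exp (-deviationLevel (p + q) n)) := by
        gcongr
        exact pow_le_exp_baseComplexity hn _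
    _ = n * Real.exp (s - deviationLevel (p + q) n) := by
        rw [sub_eq_add_neg, Real.exp_add]; ring
    _ ≤ n * Real.exp (-((n : ℝ) ^ (1 / 3 : ℝ)) - 6 * √(n : ℝ)) := by gcongr
    _ = Real.exp (-((n : ℝ) ^ (1 / 3 : ℝ))) * (n / Real.exp (6 * √(n : ℝ))) := by
        rw [Real.exp_sub]; ring
    _ ≤ _ := by
        gcongr Real.exp (-((n : ℝ) ^ (1 / 3 : ℝ))) * ?_
        rw [div_le_div_iff₀ (Real.exp_pos _) (by positivity)]
        linarith

/-- The constant `∑ 1 / n²` in the tail bound of the collapse time. -/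
noncomputable def tailConst : ℝ := ∑' n : ℕ, 1 / (n : ℝ) ^ 2

theorem summable_one_div_sq : Summable fun n : ℕ => 1 / (n : ℝ) ^ 2 :=
  Real.summable_one_div_nat_pow.2 one_lt_two

theorem tailConst_pos : 0 < tailConst :=
  -- The term at 0 is `1 / 0 = 0`, so positivity comes from the term at 1.
  summable_one_div_sq.tsum_pos (fun _ => by positivity) 1 (by norm_num)

/-- Union bound over `n ≥ m`: the exponential is at most its value at `m`, and `1/n²` is summable.
-/
theorem measure_exists_one_lt_size_le {P : Measure (JointSpace p q)}
    (hP : P ∈ IndependenceClass p q) {b δ : ℕ → ℝ}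
    (hb : ∀ n, 1 ≤ n → b n ∈ Set.Ioo (0 : ℝ) 1) (hδ : ∀ n, 1 ≤ n → δ n ∈ Set.Ioo (0 : ℝ) 1)
    {axis : ∀ n : ℕ, (Fin n → JointSpace p q) → Node → Coord p q}
    {That : ∀ n : ℕ, (Fin n → JointSpace p q) → BinTree}
    (hT : ∀ n, 1 ≤ n → ∀ z : Fin n → JointSpace p q,
      IsOptimalTree z (axis n z) (b n) (δ n) (That n z))
    {Ω : Type*} [MeasurableSpace Ω] {μ : Measure Ω} [IsProbabilityMeasure μ]
    {Z : ℕ → Ω → JointSpace p q} (hZ : ∀ i, Measurable (Z i)) (hind : iIndepFun Z μ)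
    (hlaw : ∀ i, μ.map (Z i) = P) {m : ℕ} (hm : 1 ≤ m) :
    μ {ω | ∃ n, m ≤ n ∧ 1 < (That n (firstSamples (fun i => Z i ω) n)).size} ≤
      ENNReal.ofReal (tailConst * Real.exp (-((m : ℝ) ^ (1 / 3 : ℝ)))) := by
  let E : ℕ → Set Ω := fun n => {ω | m ≤ n ∧
    firstSamples (fun i => Z i ω) n ∈ gridDeviation p q n (deviationLevel (p + q) n)}
  have hsub : {ω | ∃ n, m ≤ n ∧ 1 < (That n (firstSamples (fun i => Z i ω) n)).size} ⊆
      ⋃ n, E n := by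
    rintro ω ⟨n, hmn, hsize⟩
    have hn := hm.trans hmn
    exact Set.mem_iUnion.2 ⟨n, hmn,
      mem_gridDeviation_of_one_lt_size hn (hb n hn) (hδ n hn) (hT n hn _) hsize⟩
  have hE : ∀ n, μ (E n) ≤
      ENNReal.ofReal (Real.exp (-((m : ℝ) ^ (1 / 3 : ℝ))) * (1 / (n : ℝ) ^ 2)) := by
    intro n
    by_cases hmn : m ≤ n
    · have hmeas : Measurable fun ω => firstSamples (fun i => Z i ω) n :=
        measurable_pi_lambda _ fun i => hZ i
      have hmap : μ.map (fun ω => firstSamples (fun i => Z i ω) n) =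
          Measure.pi fun _ : Fin n => P := by
        have h := (iIndepFun_iff_map_fun_eq_pi_map fun i : Fin n => (hZ i).aemeasurable).1
          (hind.precomp (Fin.val_injective (n := n)))
        simp only [hlaw] at h
        exact h
      have hEn : E n = (fun ω => firstSamples (fun i => Z i ω) n) ⁻¹'
          gridDeviation p q n (deviationLevel (p + q) n) := by
        ext ω; simp [E, hmn]
      rw [hEn, ← Measure.map_apply hmeas (measurableSet_gridDeviation _), hmap]
      refine (measure_gridDeviation_deviationLevel_le hP (hm.trans hmn)).trans
        (ENNReal.ofReal_le_ofReal ?_)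
      gcongr
    · have hEn : E n = ∅ := by ext ω; simp [E, hmn]
      simp [hEn]
  calc _ ≤ μ (⋃ n, E n) := measure_mono hsub
    _ ≤ ∑' n, μ (E n) := measure_iUnion_le _
    _ ≤ ∑' n : ℕ, ENNReal.ofReal (Real.exp (-((m : ℝ) ^ (1 / 3 : ℝ))) * (1 / (n : ℝ) ^ 2)) :=
        ENNReal.tsum_le_tsum hE
    _ = _ := by
        rw [← ENNReal.ofReal_tsum_of_nonneg (fun _ => by positivity)
          (summable_one_div_sq.mul_left _), tsum_mul_left, mul_comm, tailConst]

theorem exists_of_le_collapseTime {That : ∀ n : ℕ, (Fin n → JointSpace p q) → BinTree}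
    {z : ℕ → JointSpace p q} {m : ℕ} (hm : 1 ≤ m) (h : (m : ℕ∞) ≤ collapseTime That z) :
    ∃ n, m ≤ n ∧ 1 < (That n (firstSamples z n)).size := by
  by_contra! hc
  -- If all trees from `m` on are trivial, the supremum is at most `m - 1`, a true predecessor
  -- because `m ≥ 1`.
  have hle : collapseTime That z ≤ ((m - 1 : ℕ) : ℕ∞) := by
    refine iSup₂_le fun n hn => ?_
    have : n < m := by
      by_contra! hmn
      exact absurd hn.2 (not_lt.2 (hc n hmn))
    exact_mod_cast Nat.le_sub_one_of_lt this
  have := h.trans hle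
  norm_cast at this
  omega

theorem one_lt_size_of_treePartition_ne {z : Fin n → JointSpace p q} {axis : Node → Coord p q}
    {T : BinTree} (h : treePartition z axis T ≠ {Set.univ}) : 1 < T.size := by
  have hpos : ∀ (T : BinTree) (v : Node), 1 ≤ (T.leavesFrom v).length := by
    intro T
    induction T with
    | leaf => intro v; simp [BinTree.leavesFrom]
    | node l r ihl ihr => intro v; simp [BinTree.leavesFrom]; have := ihl (false :: v); omega
  cases T with
  | leaf =>
    exfalso
    apply h
    ext A
    simp [treePartition, BinTree.leaves, BinTree.leavesFrom, cell, ProdCell.toSet]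
  | node l r =>
    have h1 := hpos l [false]
    have h2 := hpos r [true]
    simp only [BinTree.size, BinTree.leaves, BinTree.leavesFrom, List.length_append]
    omega

end Tail

/-! ### Asymptotics of the critical sample size -/

section CriticalSize

variable {K : ℝ}

theorem mul_exp_neg_lt_iff (hK : 0 < K) {ε : ℝ} (hε : 0 < ε) (x : ℝ) :
    K * Real.exp (-x) < ε ↔ Real.log (K / ε) < x := by
  rw [Real.log_lt_iff_lt_exp (by positivity), Real.exp_neg, ← div_eq_mul_inv,
    div_lt_iff₀ (Real.exp_pos _), div_lt_iff₀ hε, mul_comm]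

theorem lt_rpow_one_third_of_pow_lt {x : ℝ} {m : ℕ} (h : x ^ 3 < m) :
    x < (m : ℝ) ^ (1 / 3 : ℝ) := by
  refine lt_of_pow_lt_pow_left₀ 3 (by positivity) ?_
  rw [← Real.rpow_natCast ((m : ℝ) ^ (1 / 3 : ℝ)), ← Real.rpow_mul (by positivity)]
  simpa using h

theorem criticalSize_spec (hK : 0 < K) {ε : ℝ} (hε : 0 < ε) :
    1 ≤ criticalSize K ε ∧
      K * Real.exp (-((criticalSize K ε : ℝ) ^ (1 / 3 : ℝ))) < ε := by
  refine Nat.sInf_mem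
    (s := {m : ℕ | 1 ≤ m ∧ K * Real.exp (-((m : ℝ) ^ (1 / 3 : ℝ))) < ε}) ?_
  obtain ⟨m, hm⟩ := exists_nat_gt (Real.log (K / ε) ^ 3)
  refine ⟨m + 1, Nat.le_add_left _ _, ?_⟩
  rw [mul_exp_neg_lt_iff hK hε]
  exact lt_rpow_one_third_of_pow_lt (hm.trans (by simp))

theorem log_pow_lt_criticalSize (hK : 0 < K) {ε : ℝ} (hε : 0 < ε) (hεK : 0 ≤ Real.log (K / ε)) :
    Real.log (K / ε) ^ 3 < criticalSize K ε := by
  have h := (mul_exp_neg_lt_iff hK hε _).1 (criticalSize_spec hK hε).2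
  have h3 := pow_lt_pow_left₀ h hεK three_ne_zero
  rw [← Real.rpow_natCast (_ ^ (1 / 3 : ℝ)), ← Real.rpow_mul (by positivity)] at h3
  simpa using h3

theorem criticalSize_le (hK : 0 < K) {ε : ℝ} (hε : 0 < ε) (hεK : 0 ≤ Real.log (K / ε)) :
    (criticalSize K ε : ℝ) ≤ Real.log (K / ε) ^ 3 + 1 := by
  have hle : criticalSize K ε ≤ ⌊Real.log (K / ε) ^ 3⌋₊ + 1 := by
    refine Nat.sInf_le ⟨Nat.le_add_left _ _, ?_⟩
    rw [mul_exp_neg_lt_iff hK hε]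
    apply lt_rpow_one_third_of_pow_lt
    push_cast
    exact Nat.lt_floor_add_one _
  calc (criticalSize K ε : ℝ) ≤ (⌊Real.log (K / ε) ^ 3⌋₊ + 1 : ℕ) := by exact_mod_cast hle
    _ ≤ _ := by
      push_cast
      gcongr
      exact Nat.floor_le (by positivity)

theorem tendsto_log_div (hK : 0 < K) :
    Tendsto (fun ε : ℝ => Real.log (K / ε)) (𝓝[>] 0) atTop := by
  refine Real.tendsto_log_atTop.comp ?_
  exact (tendsto_inv_nhdsGT_zero.const_mul_atTop hK).congr fun ε => (div_eq_mul_inv K ε).symm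

/-- Once `L = log (K / ε) ≥ 0`, the critical size lies between `L³` and `L³ + 1`; the bounded gap is
negligible since `L → ∞`. -/
theorem criticalSize_isEquivalent (hK : 0 < K) :
    (fun ε : ℝ => (criticalSize K ε : ℝ)) ~[𝓝[>] 0] fun ε => Real.log (K / ε) ^ 3 := by
  have hbound : (fun ε : ℝ => (criticalSize K ε : ℝ) - Real.log (K / ε) ^ 3) =O[𝓝[>] 0]
      fun _ => (1 : ℝ) := by
    refine IsBigO.of_bound 1 ?_
    filter_upwards [self_mem_nhdsWithin, (tendsto_log_div hK).eventually_ge_atTop 0]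
      with ε hε hlog
    have h1 := log_pow_lt_criticalSize hK hε hlog
    have h2 := criticalSize_le hK hε hlog
    rw [Real.norm_of_nonneg (by linarith)]
    norm_num
    linarith
  refine hbound.trans_isLittleO ?_
  rw [isLittleO_const_left]
  right
  exact tendsto_norm_atTop_atTop.comp
    ((tendsto_pow_atTop three_ne_zero).comp (tendsto_log_div hK))

theorem criticalSize_isBigO (hK : 0 < K) :
    (fun ε : ℝ => (criticalSize K ε : ℝ)) =O[𝓝[>] 0] fun ε => Real.log (1 / ε) ^ 3 := by
  refine (criticalSize_isEquivalent hK).isBigO.trans (IsBigO.pow ?_ 3)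
  have h : (fun ε : ℝ => Real.log (K / ε)) =ᶠ[𝓝[>] 0]
      fun ε => Real.log K + Real.log (1 / ε) := by
    filter_upwards [self_mem_nhdsWithin] with ε hε
    have hε' : ε ≠ 0 := (Set.mem_Ioi.1 hε).ne'
    rw [← Real.log_mul hK.ne' (by positivity), mul_one_div]
  refine h.isBigO.trans (IsBigO.add ?_ (isBigO_refl _ _))
  refine IsLittleO.isBigO (isLittleO_const_left.2 (Or.inr ?_))
  exact tendsto_norm_atTop_atTop.comp (tendsto_log_div one_pos)

end CriticalSize
end TSP

theorem theorem4 :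
    ∃ K : ℝ, 0 < K ∧
      -- the tail bound and the structural detection of independence, uniformly in the model
      (∀ (p q : ℕ) (P : Measure (JointSpace p q)), P ∈ IndependenceClass p q →
        -- the design sequences
        ∀ (l : ℝ) (b δ : ℕ → ℝ), l ∈ Set.Ioo (0 : ℝ) (1 / 3) →
        (∀ n, 1 ≤ n → b n ∈ Set.Ioo (0 : ℝ) 1) →
        (∀ n, 1 ≤ n → δ n ∈ Set.Ioo (0 : ℝ) 1) →
        (b =Θ[atTop] fun n : ℕ => (n : ℝ) ^ (-l)) →
        ((fun n => 1 / δ n) =Θ[atTop] fun n : ℕ => Real.exp ((n : ℝ) ^ (1 / 3 : ℝ))) →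
        -- the rule that selects the coordinates, and the rule that selects the optimal trees
        ∀ (axis : ∀ n : ℕ, (Fin n → JointSpace p q) → Node → Coord p q)
          (That : ∀ n : ℕ, (Fin n → JointSpace p q) → BinTree),
        (∀ n, 1 ≤ n → ∀ z : Fin n → JointSpace p q,
          IsOptimalTree z (axis n z) (b n) (δ n) (That n z)) →
        -- the i.i.d. process with marginal law `P`
        ∀ (Ω : Type*) [MeasurableSpace Ω] (μ : Measure Ω) [IsProbabilityMeasure μ]
          (Z : ℕ → Ω → JointSpace p q),
        (∀ i, Measurable (Z i)) → iIndepFun Z μ → (∀ i, μ.map (Z i) = P) →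
          (∀ m : ℕ, 1 ≤ m →
            μ {ω | (m : ℕ∞) ≤ collapseTime That (fun i => Z i ω)} ≤
              ENNReal.ofReal (K * Real.exp (-((m : ℝ) ^ (1 / 3 : ℝ))))) ∧
          (∀ ε : ℝ, 0 < ε →
            μ {ω | ∃ n, criticalSize K ε ≤ n ∧
              treePartition (firstSamples (fun i => Z i ω) n)
                (axis n (firstSamples (fun i => Z i ω) n))
                (That n (firstSamples (fun i => Z i ω) n)) ≠ {Set.univ}} <
              ENNReal.ofReal ε)) ∧
      -- the order of the critical number of samples
      ((fun ε : ℝ => (criticalSize K ε : ℝ)) ~[𝓝[>] 0] fun ε => Real.log (K / ε) ^ 3) ∧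
      ((fun ε : ℝ => (criticalSize K ε : ℝ)) =O[𝓝[>] 0] fun ε => Real.log (1 / ε) ^ 3) := by
  refine ⟨tailConst, tailConst_pos, ?_, criticalSize_isEquivalent tailConst_pos,
    criticalSize_isBigO tailConst_pos⟩
  intro p q P hP l b δ _ hb hδ _ _ axis That hT Ω _ μ _ Z hZ hind hlaw
  refine ⟨fun m hm => ?_, fun ε hε => ?_⟩
  · exact (measure_mono fun ω hω => exists_of_le_collapseTime hm hω).trans
      (measure_exists_one_lt_size_le hP hb hδ hT hZ hind hlaw hm)
  · obtain ⟨hm, hlt⟩ := criticalSize_spec tailConst_pos hε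
    refine lt_of_le_of_lt ((measure_mono ?_).trans
      (measure_exists_one_lt_size_le hP hb hδ hT hZ hind hlaw hm))
      ((ENNReal.ofReal_lt_ofReal_iff hε).2 hlt)
    rintro ω ⟨n, hn, hne⟩
    exact ⟨n, hn, one_lt_size_of_treePartition_ne hne⟩
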